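/- \textbf{Setting.} There are $N$ independent messages $M_1,\dots,M_N$ and $K$ senders. Sender $k$ knows the messages with indices in $\mathcal S_k\subseteq[1:N]$ (the $\mathcal S_k$ are distinct and $\bigcup_k\mathcal S_k=[1:N]$) and has a noiseless broadcast link of capacity $C_k>0$ bits per channel use to all of the $N$ receivers. Receiver $j$ knows the messages with indices in $\mathcal A_j\subseteq[1:N]\setminus\{j\}$ and requests $M_j$. An index code of block length $n$ for the rates $(R_1,\dots,R_N)\in\mathbb R_+^N$ consists of encoders $f_k:\prod_{i\in\mathcal S_k}\mathbb M_i\to\{1,\dots,2^{\lfloor nC_k\rfloor}\}$ and decoders $g_j:\prod_{k}\{1,\dots,2^{\lfloor nC_k\rfloor}\}\times\prod_{i\in\mathcal A_j}\mathbb M_i\to\mathbb M_j$, where $\mathbb M_j=\{1,\dots,2^{\lceil nR_j\rceil}\}$. The tuple $(R_1,\dots,R_N)$ is achievable if there is a sequence of such codes ($n=0,1,2,\dots$) for which the probability, under independent uniform messages, that some receiver $j$ does not recover $M_j$ tends to $0$. A finite set $\tilde\Pi$ of nonempty subsets $\tilde P\subseteq[1:K]$ with $\bigcup_{\tilde P\in\tilde\Pi}\tilde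 P=[1:K]$ is called admissible; $\tilde{\mathbf\Pi}_{\mathrm{LS}}$ is the set of all of these. A link split $\mathbf C_{\tilde\Pi}=(C_{k,\tilde P})_{\tilde P\in\tilde\Pi,\,k\in\tilde P}$ is admissible if all $C_{k,\tilde P}>0$ and $\sum_{\tilde P\in\tilde\Pi:\,k\in\tilde P}C_{k,\tilde P}\le C_k$ for every $k$. Put $\mathcal S_{\tilde P}=\bigcup_{k\in\tilde P}\mathcal S_k$, $\mathcal A_{j,\tilde P}=\mathcal A_j\cap\mathcal S_{\tilde P}$, and $\mathcal I_{T}=\bigcup_{k\in T}\{\mathcal J:\mathcal J\subseteq\mathcal S_k\}$ for $T\subseteq[1:K]$. A decoding choice in $\tilde P$ is a family of sets with $j\in\mathcal D_{j,\tilde P}\subseteq\mathcal S_{\tilde P}\setminus\mathcal A_{j,\tilde P}$, $j\in\mathcal S_{\tilde P}$. For nonnegative sub-message rates $R_{j,\tilde P}$ ($j\in\mathcal S_{\tilde P}$) and composite rates $\gamma_{\mathcal J,\tilde P}$ ($\mathcal J\in\mathcal I_{\tilde P}$), the constraints of the group $\tilde P$ are \[\text{(a)}\quad \sum_{i\in T}R_{i,\tilde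 P}<\sum_{\substack{\mathcal J\in\mathcal I_{\tilde P}:\ \mathcal J\subseteq\mathcal D_{j,\tilde P}\cup\mathcal A_{j,\tilde P},\\ \mathcal J\cap T\neq\emptyset}}\gamma_{\mathcal J,\tilde P}\qquad\text{for all } j\in\mathcal S_{\tilde P},\ \emptyset\ne T\subseteq\mathcal D_{j,\tilde P},\] \[\text{(b)}\quad \sum_{\substack{\mathcal J\in\mathcal I_{\tilde{\mathcal K}}\setminus\mathcal I_{\tilde P\setminus\tilde{\mathcal K}}:\\ \mathcal J\not\subseteq\mathcal A_{j,\tilde P}}}\gamma_{\mathcal J,\tilde P}<\sum_{k\in\tilde{\mathcal K}}C_{k,\tilde P}\qquad\text{for all } j\in\mathcal S_{\tilde P},\ \emptyset\neq\tilde{\mathcal K}\subseteq\tilde P.\] Let $\mathcal R_{(\tilde P,\mathbf C_{\tilde P})}$ be the set of all $(R_{j,\tilde P})_{j\in\mathcal S_{\tilde P}}\ge0$ for which (a) and (b) hold for some decoding choice and some $\gamma\ge0$. Let $\mathcal R_{\mathrm{CLS}}(\tilde\Pi,\mathbf C_{\tilde\Pi})$ be the set of all $(R_1,\dots,R_N)$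 with $R_j=\sum_{\tilde P\in\tilde\Pi:\,j\in\mathcal S_{\tilde P}}R_{j,\tilde P}$, where, for some admissible $\mathbf C_{\tilde\Pi}$, $(R_{j,\tilde P})_{j\in\mathcal S_{\tilde P}}\in\mathcal R_{(\tilde P,\mathbf C_{\tilde P})}$ for all $\tilde P\in\tilde\Pi$. Let $\mathcal R_{\mathrm{CLS}}=\mathrm{conv}\bigcup_{\tilde\Pi\in\tilde{\mathbf\Pi}_{\mathrm{LS}}}\mathcal R_{\mathrm{CLS}}(\tilde\Pi,\mathbf C_{\tilde\Pi})$. In cooperative composite coding (CCC) with these parameters, $M_j$ is split into sub-messages $M_{j,\tilde P}\in\{1,\dots,2^{\lceil nR_{j,\tilde P}\rceil}\}$, one for each $\tilde P\in\tilde\Pi$ with $j\in\mathcal S_{\tilde P}$. In each group $\tilde P$ every composite message $(M_{i,\tilde P})_{i\in\mathcal J}$, $\mathcal J\in\mathcal I_{\tilde P}$, is mapped to a composite index $W_{\mathcal J,\tilde P}\in\{1,\dots,2^{\lfloor n\gamma_{\mathcal J,\tilde P}\rfloor}\}$, by the same map at all senders that have it. Sender $k\in\tilde P$ maps $(W_{\mathcal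 J,\tilde P})_{\mathcal J\subseteq\mathcal S_k}$ to a bin index in $\{1,\dots,2^{\lfloor nC_{k,\tilde P}\rfloor}\}$, and sends its bin indices for all its groups over its link. In every group with $j\in\mathcal S_{\tilde P}$, receiver $j$ first declares the unique tuple of composite indices $(W_{\mathcal J,\tilde P})_{\mathcal J\in\mathcal I_{\tilde P}}$ compatible with the bin indices and its side information, and then the unique tuple $(M_{i,\tilde P})_{i\in\mathcal D_{j,\tilde P}}$ compatible with its side information and those $W_{\mathcal J,\tilde P}$ with $\mathcal J\subseteq\mathcal D_{j,\tilde P}\cup\mathcal A_{j,\tilde P}$ (simultaneous nonunique decoding); it then reassembles $M_j$. \textbf{Proposition (CCC rate region).} (1) Let $\tilde\Pi$ and $\mathbf C_{\tilde\Pi}$ be admissible, and let a decoding choice, composite rates and sub-message rates be given that are nonnegative and satisfy (a) and (b) for every $\tilde P\in\tilde\Pi$. Then there is a sequence of CCC codes with these parameters, of block lengths $n\to\infty$, whose probability of error tends to $0$. (2) For every admissible $\tilde\Pi$, every rate tuple in $\mathcal R_{\mathrm{CLS}}(\tilde\Pi,\mathbf C_{\tilde\Pi})$ is achievable. (3) Every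 rate tuple in the convex hull $\mathcal R_{\mathrm{CLS}}$ is achievable. -/

import Mathlib

open Filter Topology

noncomputable section

/-- A multi-sender unicast index-coding problem with `N` independent messages (and `N` receivers,
receiver `j` requesting message `j`) and `K` senders. -/
structure IndexCodingProblem (N K : ℕ) where
  /-- `S k` is the set of message indices available at sender `k`. -/
  S : Fin K → Finset (Fin N)
  /-- Different senders have different message sets. -/
  S_injective : Function.Injective S
  /-- Every message is available at some sender. -/
  S_cover : ∀ j, ∃ k, j ∈ S k
  /-- `A j` is the side information of receiver `j`. -/
  A : Fin N → Finset (Fin N)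
  /-- The side information does not contain the requested message. -/
  not_mem_A : ∀ j, j ∉ A j
  /-- `C k` is the capacity, in bits per channel use, of the broadcast link of sender `k`. -/
  C : Fin K → ℝ
  C_pos : ∀ k, 0 < C k

/-- The set `[1 : 2^(n R)]` of `2 ^ ⌈n R⌉` messages, for a message of rate `R`. -/
abbrev MsgSet (n : ℕ) (R : ℝ) : Type := Fin (2 ^ ⌈(n : ℝ) * R⌉₊)

/-- The set `[1 : 2^(n C))` of `2 ^ ⌊n C⌋` indices, for a link or a composite index of rate `C`. -/
abbrev IdxSet (n : ℕ) (C : ℝ) : Type := Fin (2 ^ ⌊(n : ℝ) * C⌋₊)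

namespace IndexCodingProblem

variable {N K : ℕ} (I : IndexCodingProblem N K)

/-! ### Index codes and achievability -/

/-- A multi-sender index code of block length `n` for the message rates `R`. -/
structure IndexCode (n : ℕ) (R : Fin N → ℝ) where
  /-- The encoder of sender `k`, a function of the messages of sender `k` only. -/
  enc : ∀ k : Fin K, (∀ i : {i // i ∈ I.S k}, MsgSet n (R i)) → IdxSet n (I.C k)
  /-- The decoder of receiver `j`, a function of all received indices and the side information. -/
  dec : ∀ j : Fin N, (∀ k : Fin K, IdxSet n (I.C k)) →
    (∀ i : {i // i ∈ I.A j}, MsgSet n (R i)) → MsgSet n (R j)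

/-- The estimate of message `j` at receiver `j` when the messages are `m`. -/
def IndexCode.estimate {I : IndexCodingProblem N K} {n : ℕ} {R : Fin N → ℝ} (c : I.IndexCode n R)
    (m : ∀ j, MsgSet n (R j)) (j : Fin N) : MsgSet n (R j) :=
  c.dec j (fun k => c.enc k fun i => m i) fun i => m i

open scoped Classical in
/-- The average probability of error for independent uniform messages, that is, the fraction of the
message tuples for which at least one receiver errs. -/
def IndexCode.errorProb {I : IndexCodingProblem N K} {n : ℕ} {R : Fin N → ℝ}
    (c : I.IndexCode n R) : ℝ :=
  ((Finset.univ.filter fun m : ∀ j, MsgSet n (R j) => ∃ j, c.estimate m j ≠ m j).card : ℝ) /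
    (Fintype.card (∀ j, MsgSet n (R j)) : ℝ)

/-- A nonnegative rate tuple is achievable if some sequence of index codes, one for each block
length, has vanishing average probability of error. -/
def Achievable (R : Fin N → ℝ) : Prop :=
  (∀ j, 0 ≤ R j) ∧ ∃ c : ∀ n : ℕ, I.IndexCode n R, Tendsto (fun n => (c n).errorProb) atTop (𝓝 0)

/-! ### Joint link-and-sender partitions and decoding choices -/

/-- A family of (distinct) sender groups is admissible if its members are nonempty and
cover the set of all senders. -/
def AdmissibleGroups (Q : Finset (Finset (Fin K))) : Prop :=
  (∀ P ∈ Q, P.Nonempty) ∧ ∀ k, ∃ P ∈ Q, k ∈ P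

/-- The link fractions `c P k`, for `P ∈ Q` and `k ∈ P`, form an admissible link partition. -/
def AdmissibleLinks (Q : Finset (Finset (Fin K))) (c : Finset (Fin K) → Fin K → ℝ) : Prop :=
  (∀ P ∈ Q, ∀ k ∈ P, 0 < c P k) ∧ ∀ k, ∑ P ∈ Q with k ∈ P, c P k ≤ I.C k

/-- The messages available in the group `P`. -/
def groupMsgs (P : Finset (Fin K)) : Finset (Fin N) := P.biUnion I.S

/-- The side information of receiver `j` in the group `P`. -/
def groupSide (P : Finset (Fin K)) (j : Fin N) : Finset (Fin N) := I.A j ∩ I.groupMsgs P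

/-- The index sets of the composite messages that some sender in `T` has. -/
def composites (T : Finset (Fin K)) : Finset (Finset (Fin N)) :=
  T.biUnion fun k => (I.S k).powerset

/-- A decoding choice for the receivers of the messages in the group `P`. (The values of `D` at
other receivers are never used; the same convention holds for all families below that are indexed
by more than the relevant indices.) -/
structure DecodingChoice (P : Finset (Fin K)) where
  D : Fin N → Finset (Fin N)
  subset : ∀ j ∈ I.groupMsgs P, D j ⊆ I.groupMsgs P \ I.groupSide P j
  mem : ∀ j ∈ I.groupMsgs P, j ∈ D j

/-! ### The rate regions -/

/-- Constraints (a), on the message rates `r` in the group `P` for composite rates `γ`. -/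
def MessageConstraints (P : Finset (Fin K)) (D : I.DecodingChoice P) (γ : Finset (Fin N) → ℝ)
    (r : Fin N → ℝ) : Prop :=
  ∀ j ∈ I.groupMsgs P, ∀ T ⊆ D.D j, T.Nonempty →
    ∑ i ∈ T, r i <
      ∑ J ∈ I.composites P with J ⊆ D.D j ∪ I.groupSide P j ∧ (J ∩ T).Nonempty, γ J

/-- Constraints (b), on the composite rates `γ` in the group `P` with link fractions `c`. -/
def CompositeConstraints (P : Finset (Fin K)) (c : Fin K → ℝ) (γ : Finset (Fin N) → ℝ) : Prop :=
  ∀ j ∈ I.groupMsgs P, ∀ T ⊆ P, T.Nonempty →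
    ∑ J ∈ I.composites T with J ∉ I.composites (P \ T) ∧ ¬ J ⊆ I.groupSide P j, γ J < ∑ k ∈ T, c k

/-- All rate constraints in the group `P`: nonnegativity, (a) and (b). -/
def GroupConstraints (P : Finset (Fin K)) (c : Fin K → ℝ) (D : I.DecodingChoice P)
    (γ : Finset (Fin N) → ℝ) (r : Fin N → ℝ) : Prop :=
  (∀ j ∈ I.groupMsgs P, 0 ≤ r j) ∧ (∀ J ∈ I.composites P, 0 ≤ γ J) ∧
    I.MessageConstraints P D γ r ∧ I.CompositeConstraints P c γ

/-- The rate region of the link-sender group `(P, c)` under the decoding choice `D`. -/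
def regionOfChoice (P : Finset (Fin K)) (c : Fin K → ℝ) (D : I.DecodingChoice P) :
    Set (Fin N → ℝ) :=
  {r | ∃ γ : Finset (Fin N) → ℝ, I.GroupConstraints P c D γ r}

/-- The rate region of the link-sender group `(P, c)`: the union over all decoding choices. -/
def regionOfGroup (P : Finset (Fin K)) (c : Fin K → ℝ) : Set (Fin N → ℝ) :=
  ⋃ D : I.DecodingChoice P, I.regionOfChoice P c D

/-- The message rates obtained by adding up the rates of the sub-messages. -/
def totalRate (Q : Finset (Finset (Fin K))) (r : Finset (Fin K) → Fin N → ℝ) (j : Fin N) : ℝ :=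
  ∑ P ∈ Q with j ∈ I.groupMsgs P, r P j

/-- The rate region of the family `Q` of sender groups (for some admissible link partition). -/
def regionOfGroups (Q : Finset (Finset (Fin K))) : Set (Fin N → ℝ) :=
  {R | ∃ c : Finset (Fin K) → Fin K → ℝ, I.AdmissibleLinks Q c ∧
    ∃ r : Finset (Fin K) → Fin N → ℝ, (∀ P ∈ Q, r P ∈ I.regionOfGroup P (c P)) ∧
      R = I.totalRate Q r}

/-- The convex hull of the union of the regions of all admissible families of sender groups. -/
def regionCLS : Set (Fin N → ℝ) :=
  convexHull ℝ (⋃ Q ∈ {Q : Finset (Finset (Fin K)) | AdmissibleGroups Q}, I.regionOfGroups Q)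

/-! ### Cooperative composite coding -/

lemma mem_groupMsgs {P : Finset (Fin K)} {k : Fin K} (hk : k ∈ P) {i : Fin N} (hi : i ∈ I.S k) :
    i ∈ I.groupMsgs P := Finset.mem_biUnion.2 ⟨k, hk, hi⟩

lemma mem_composites {P : Finset (Fin K)} {k : Fin K} (hk : k ∈ P) {J : Finset (Fin N)}
    (hJ : J ⊆ I.S k) : J ∈ I.composites P :=
  Finset.mem_biUnion.2 ⟨k, hk, Finset.mem_powerset.2 hJ⟩

/-- The codebooks of cooperative composite coding at block length `n`, for sender groups `Q`, link
fractions `c`, composite rates `γ` and sub-message rates `r`. -/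
structure CompositeCode (Q : Finset (Finset (Fin K))) (c : Finset (Fin K) → Fin K → ℝ)
    (γ : Finset (Fin K) → Finset (Fin N) → ℝ) (r : Finset (Fin K) → Fin N → ℝ) (n : ℕ) where
  /-- Message `j` is split into one sub-message for each group with access to it ... -/
  split : ∀ j : Fin N, MsgSet n (I.totalRate Q r j) →
    ∀ P : {P // P ∈ Q ∧ j ∈ I.groupMsgs P}, MsgSet n (r P j)
  /-- ... and reassembled from its sub-messages. -/
  merge : ∀ j : Fin N, (∀ P : {P // P ∈ Q ∧ j ∈ I.groupMsgs P}, MsgSet n (r P j)) →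
    MsgSet n (I.totalRate Q r j)
  merge_split : ∀ j m, merge j (split j m) = m
  /-- The composite message `J` of the group `P` is binned into a composite index. This map is
  common to all the senders of the group that have the composite message. -/
  comp : ∀ (P : Finset (Fin K)) (J : Finset (Fin N)),
    (∀ i : {i // i ∈ J}, MsgSet n (r P i)) → IdxSet n (γ P J)
  /-- Sender `k` bins all its composite indices for the group `P` into one bin index. -/
  bin : ∀ (P : Finset (Fin K)) (k : Fin K),
    (∀ J : {J // J ⊆ I.S k}, IdxSet n (γ P J)) → IdxSet n (c P k)
  /-- The bin indices of sender `k` for its groups are sent jointly over its link ... -/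
  mux : ∀ k : Fin K, (∀ P : {P // P ∈ Q ∧ k ∈ P}, IdxSet n (c P k)) → IdxSet n (I.C k)
  /-- ... and are separated again by the receivers. -/
  demux : ∀ k : Fin K, IdxSet n (I.C k) → ∀ P : {P // P ∈ Q ∧ k ∈ P}, IdxSet n (c P k)
  demux_mux : ∀ k L, demux k (mux k L) = L

namespace CompositeCode

variable {I} {Q : Finset (Finset (Fin K))} {c : Finset (Fin K) → Fin K → ℝ}
  {γ : Finset (Fin K) → Finset (Fin N) → ℝ} {r : Finset (Fin K) → Fin N → ℝ} {n : ℕ}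
  (X : I.CompositeCode Q c γ r n)

/-- The bin index of sender `k` for the group `P`, when the messages of sender `k` are `m`. -/
def binIndex (k : Fin K) (m : ∀ i : {i // i ∈ I.S k}, MsgSet n (I.totalRate Q r i))
    (P : {P // P ∈ Q ∧ k ∈ P}) : IdxSet n (c P k) :=
  X.bin P k fun J => X.comp P J fun i =>
    X.split i (m ⟨i, J.2 i.2⟩) ⟨P, P.2.1, I.mem_groupMsgs P.2.2 (J.2 i.2)⟩

/-- The composite indices `w` of the group `P` are compatible with the bin indices `L` and with the
sub-messages `a` that receiver `j` has as side information. -/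
def IndicesCompatible (P : Finset (Fin K)) (j : Fin N) (L : ∀ k : {k // k ∈ P}, IdxSet n (c P k))
    (a : ∀ i : {i // i ∈ I.groupSide P j}, MsgSet n (r P i))
    (w : ∀ J : {J // J ∈ I.composites P}, IdxSet n (γ P J)) : Prop :=
  (∀ k : {k // k ∈ P}, X.bin P k (fun J => w ⟨J, I.mem_composites k.2 J.2⟩) = L k) ∧
    ∀ (J : {J // J ∈ I.composites P}) (hJ : J.1 ⊆ I.groupSide P j),
      X.comp P J (fun i => a ⟨i, hJ i.2⟩) = w J

/-- The sub-messages `x` with indices in `D ∪ A` are compatible with the composite indices `w` and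
with the sub-messages `a` that receiver `j` has as side information. -/
def MessagesCompatible (P : Finset (Fin K)) (j : Fin N) (D : Finset (Fin N))
    (a : ∀ i : {i // i ∈ I.groupSide P j}, MsgSet n (r P i))
    (w : ∀ J : {J // J ∈ I.composites P}, IdxSet n (γ P J))
    (x : ∀ i : {i // i ∈ D ∪ I.groupSide P j}, MsgSet n (r P i)) : Prop :=
  (∀ i : {i // i ∈ I.groupSide P j}, x ⟨i, Finset.mem_union_right _ i.2⟩ = a i) ∧
    ∀ (J : {J // J ∈ I.composites P}) (hJ : J.1 ⊆ D ∪ I.groupSide P j),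
      X.comp P J (fun i => x ⟨i, hJ i.2⟩) = w J

open scoped Classical in
/-- First decoding step: receiver `j` looks for the unique tuple of all the composite indices of the
group that is compatible with what it knows (an arbitrary tuple is declared if there is none). -/
def decodeIndices (P : Finset (Fin K)) (j : Fin N) (L : ∀ k : {k // k ∈ P}, IdxSet n (c P k))
    (a : ∀ i : {i // i ∈ I.groupSide P j}, MsgSet n (r P i)) :
    ∀ J : {J // J ∈ I.composites P}, IdxSet n (γ P J) :=
  if h : ∃! w, X.IndicesCompatible P j L a w then h.choose else fun _ => 0

open scoped Classical in
/-- Second decoding step (simultaneous nonunique decoding): receiver `j` looks for the unique tuple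
of sub-messages with indices in `D` that is compatible with the composite indices `w` of the
composite messages within `D ∪ A` and with its side information, and keeps its own sub-message. -/
def decodeMessage (P : Finset (Fin K)) (j : Fin N) (D : Finset (Fin N)) (hj : j ∈ D)
    (a : ∀ i : {i // i ∈ I.groupSide P j}, MsgSet n (r P i))
    (w : ∀ J : {J // J ∈ I.composites P}, IdxSet n (γ P J)) : MsgSet n (r P j) :=
  if h : ∃! x, X.MessagesCompatible P j D a w x then
    h.choose ⟨j, Finset.mem_union_left _ hj⟩ else 0

/-- The index code given by the codebooks `X` and the decoding choices `D`. -/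
def toIndexCode (D : ∀ P, I.DecodingChoice P) : I.IndexCode n (I.totalRate Q r) where
  enc k m := X.mux k (X.binIndex k m)
  dec j L a := X.merge j fun P =>
    let side : ∀ i : {i // i ∈ I.groupSide P j}, MsgSet n (r P i) := fun i =>
      X.split i (a ⟨i, (Finset.mem_inter.1 i.2).1⟩) ⟨P, P.2.1, (Finset.mem_inter.1 i.2).2⟩
    X.decodeMessage P j ((D P).D j) ((D P).mem j P.2.2) side
      (X.decodeIndices P j (fun k => X.demux k (L k) ⟨P, P.2.1, k.2⟩) side)

end CompositeCode

/-- Cooperative composite coding with sender groups `Q`, link fractions `c`, decoding choices `D`,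
composite rates `γ` and sub-message rates `r` is reliable: for suitable codebooks at each block
length, the average probability of error of the resulting index codes vanishes. -/
def CCCReliable (Q : Finset (Finset (Fin K))) (c : Finset (Fin K) → Fin K → ℝ)
    (D : ∀ P, I.DecodingChoice P) (γ : Finset (Fin K) → Finset (Fin N) → ℝ)
    (r : Finset (Fin K) → Fin N → ℝ) : Prop :=
  ∃ X : ∀ n : ℕ, I.CompositeCode Q c γ r n,
    Tendsto (fun n => ((X n).toIndexCode D).errorProb) atTop (𝓝 0)

end IndexCodingProblem

end

noncomputable section

/-! ### Uniform probabilities on finite types -/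

/-! The proof is random coding with two layers of binning. All composite maps and all bin maps are
drawn independently and uniformly. In every group the true composite indices, and then the true
sub-messages, are always compatible with what a receiver knows, so an error forces a second
compatible tuple.

Wrong tuples are sorted by the set `T` of coordinates where they differ from the true one. Up to
bounded factors there are at most 2^(n · rate of `T`) of them. Each survives with probability at
most about 2^(-n · rate of the bins that see a coordinate in `T`), because those bins receive a
changed input. The union bound is `uniformProb_exists_same_bins_le`, and `tendsto_prod_mul_prod_inv`
makes it vanish when the exponent is negative. Constraint (b) says exactly this for composite
indices binned at the senders, and (a) for sub-messages binned into composite indices. The bounds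
hold for each fixed message tuple, hence on average, so some codebook meets them
(`exists_errorProb_le`). Splitting messages and sharing links are mere counting
(`nonempty_of_links`).

For the convex hull, concatenating two codes costs some rate through rounding. Since (a) is strict,
every point of a region lies strictly below another achievable tuple, and the set of such points is
convex. -/

open scoped Classical in
/-- The probability of the event `p` under the uniform distribution on `α`. -/
def uniformProb {α : Type*} [Fintype α] (p : α → Prop) : ℝ :=
  ((Finset.univ.filter p).card : ℝ) / (Fintype.card α : ℝ)

section uniformProb

variable {α β : Type*} [Fintype α] [Fintype β]

lemma uniformProb_nonneg (p : α → Prop) : 0 ≤ uniformProb p := by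
  unfold uniformProb; positivity

lemma uniformProb_mono {p q : α → Prop} (h : ∀ a, p a → q a) : uniformProb p ≤ uniformProb q := by
  classical
  unfold uniformProb
  gcongr with a
  exact h a

lemma uniformProb_le_one (p : α → Prop) : uniformProb p ≤ 1 := by
  classical
  refine div_le_one_of_le₀ ?_ (by positivity)
  exact_mod_cast Finset.card_le_univ _

lemma uniformProb_congr_equiv (e : α ≃ β) (p : β → Prop) :
    uniformProb (fun a => p (e a)) = uniformProb p := by
  classical
  unfold uniformProb
  rw [Fintype.card_congr e]
  congr 2
  exact Finset.card_equiv e (by simp)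

lemma uniformProb_or_le (p q : α → Prop) :
    uniformProb (fun a => p a ∨ q a) ≤ uniformProb p + uniformProb q := by
  classical
  unfold uniformProb
  rw [← add_div]
  gcongr
  refine le_trans (Nat.cast_le.2 (Finset.card_le_card (t := Finset.univ.filter p ∪
    Finset.univ.filter q) fun a => by simp)) ?_
  exact_mod_cast Finset.card_union_le _ _

lemma uniformProb_exists_le {ι : Type*} (s : Finset ι) (p : ι → α → Prop) :
    uniformProb (fun a => ∃ i ∈ s, p i a) ≤ ∑ i ∈ s, uniformProb (p i) := by
  classical
  unfold uniformProb
  rw [← Finset.sum_div]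
  gcongr
  refine le_trans (Nat.cast_le.2 (Finset.card_le_card
    (t := s.biUnion fun i => Finset.univ.filter (p i)) fun a => by simp)) ?_
  exact_mod_cast Finset.card_biUnion_le

lemma uniformProb_prod (p : α × β → Prop) :
    uniformProb p = (∑ a, uniformProb fun b => p (a, b)) / Fintype.card α := by
  classical
  unfold uniformProb
  rw [← Finset.sum_div, div_div, Fintype.card_prod]
  simp only [Finset.card_filter, Nat.cast_sum, Fintype.sum_prod_type]
  push_cast
  rw [mul_comm]

lemma uniformProb_prod_le {ε : ℝ} (hε : 0 ≤ ε) {p : α × β → Prop}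
    (h : ∀ a, uniformProb (fun b => p (a, b)) ≤ ε) : uniformProb p ≤ ε := by
  rw [uniformProb_prod]
  refine div_le_of_le_mul₀ (by positivity) hε ?_
  calc _ ≤ ∑ _a : α, ε := Finset.sum_le_sum fun a _ => h a
    _ = _ := by simp [mul_comm]

lemma uniformProb_prod_le' {ε : ℝ} (hε : 0 ≤ ε) {p : α × β → Prop}
    (h : ∀ b, uniformProb (fun a => p (a, b)) ≤ ε) : uniformProb p ≤ ε := by
  rw [← uniformProb_congr_equiv (Equiv.prodComm β α)]
  exact uniformProb_prod_le hε h

/-- Some value does no worse than the average. This is the derandomization step: it fixes the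
codebook, and later the padding bits in time sharing. -/
lemma exists_uniformProb_le [Nonempty α] {ε : ℝ} {p : α × β → Prop} (h : uniformProb p ≤ ε) :
    ∃ a, uniformProb (fun b => p (a, b)) ≤ ε := by
  rw [uniformProb_prod, div_le_iff₀ (by exact_mod_cast Fintype.card_pos)] at h
  by_contra! hlt
  have : ∑ _a : α, ε < ∑ a, uniformProb fun b => p (a, b) :=
    Finset.sum_lt_sum_of_nonempty Finset.univ_nonempty fun a _ => hlt a
  simp [mul_comm] at this
  linarith

lemma uniformProb_pi {ι : Type*} [Fintype ι] [DecidableEq ι] {Ω : ι → Type*} [∀ i, Fintype (Ω i)]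
    (p : ∀ i, Ω i → Prop) :
    uniformProb (fun ω : ∀ i, Ω i => ∀ i, p i (ω i)) = ∏ i, uniformProb (p i) := by
  classical
  unfold uniformProb
  rw [Finset.prod_div_distrib, Fintype.card_pi]
  push_cast
  congr 1
  rw [← Nat.cast_prod, ← Fintype.card_piFinset]
  congr 2
  ext; simp

/-- Independence of the coordinates. Only an inequality survives, since an empty factor outside `s`
makes the left side zero. -/
lemma uniformProb_forall_mem_le {ι : Type*} [Fintype ι] [DecidableEq ι] {Ω : ι → Type*}
    [∀ i, Fintype (Ω i)] (s : Finset ι) (p : ∀ i, Ω i → Prop) :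
    uniformProb (fun ω : ∀ i, Ω i => ∀ i ∈ s, p i (ω i)) ≤ ∏ i ∈ s, uniformProb (p i) := by
  rw [uniformProb_pi fun i a => i ∈ s → p i a, ← Finset.prod_mul_prod_compl s]
  calc _ ≤ (∏ i ∈ s, uniformProb fun a => i ∈ s → p i a) * 1 := by
        refine mul_le_mul_of_nonneg_left ?_ (Finset.prod_nonneg fun _ _ => uniformProb_nonneg _)
        exact Finset.prod_le_one (fun _ _ => uniformProb_nonneg _) fun _ _ => uniformProb_le_one _
    _ = _ := by
        rw [mul_one]
        refine Finset.prod_congr rfl fun i hi => ?_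
        simp [hi]

lemma uniformProb_eval_le {ι : Type*} [Fintype ι] [DecidableEq ι] {Ω : ι → Type*}
    [∀ i, Fintype (Ω i)] (i : ι) (p : Ω i → Prop) :
    uniformProb (fun ω : ∀ i, Ω i => p (ω i)) ≤ uniformProb p := by
  have h := uniformProb_forall_mem_le (Ω := Ω) {i} fun k a => ∀ h : k = i, p (h ▸ a)
  rw [Finset.prod_singleton] at h
  refine (uniformProb_mono fun ω hω k hk hki => ?_).trans
    (h.trans (uniformProb_mono fun a ha => ha rfl))
  subst hki
  exact hω

/-- A uniformly random function takes equal values at two points with probability `1 / |β|`. -/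
lemma uniformProb_collision_le [DecidableEq α] {x y : α} (hxy : x ≠ y) :
    uniformProb (fun f : α → β => f x = f y) ≤ (Fintype.card β : ℝ)⁻¹ := by
  classical
  rcases isEmpty_or_nonempty β with hβ | hβ
  · have : IsEmpty (α → β) := ⟨fun f => hβ.elim (f x)⟩
    simp [uniformProb]
  have key : (Finset.univ.filter fun f : α → β => f x = f y).card * Fintype.card β
      ≤ Fintype.card (α → β) := by
    rw [← Finset.card_univ (α := β), ← Finset.card_product]
    -- Overwriting the value at `y` loses nothing: for a colliding `f` it is still stored at `x`.
    refine Finset.card_le_card_of_injOn (fun q => Function.update q.1 y q.2) (by simp) ?_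
    rintro ⟨f, b⟩ hf ⟨g, b'⟩ hg h
    simp only [Finset.coe_product, Finset.coe_filter, Finset.mem_univ, true_and, Finset.coe_univ,
      Set.mem_prod, Set.mem_ofPred_eq, Set.mem_univ, and_true] at hf hg
    simp only at h
    have hne : ∀ z, z ≠ y → f z = g z := fun z hz => by
      simpa [hz] using congrFun h z
    have hb : b = b' := by simpa using congrFun h y
    have hfg : f = g := by
      ext z
      by_cases hz : z = y
      · rw [hz, ← hf, ← hg, hne x hxy]
      · exact hne z hz
    rw [hfg, hb]
  unfold uniformProb
  rw [div_le_iff₀ (by exact_mod_cast Fintype.card_pos), ← div_eq_inv_mul,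
    le_div_iff₀ (by exact_mod_cast Fintype.card_pos)]
  exact_mod_cast key

end uniformProb

lemma exists_leftInverse_of_card_le {α β : Type*} [Fintype α] [Fintype β] [Nonempty α]
    (h : Fintype.card α ≤ Fintype.card β) :
    ∃ (f : α → β) (g : β → α), Function.LeftInverse g f := by
  obtain ⟨f⟩ := Function.Embedding.nonempty_of_card_le h
  exact ⟨f, Function.invFun f, Function.leftInverse_invFun f.injective⟩

/-! ### Random binning -/

/-- Independent uniformly random functions: the probability that each `h b`, `b ∈ s`, has a
collision at two given distinct points. -/
lemma uniformProb_collisions_le {B : Type*} [Fintype B] [DecidableEq B] {F Y : B → Type*}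
    [∀ b, Fintype (F b)] [∀ b, DecidableEq (F b)] [∀ b, Fintype (Y b)] {q : B → Prop}
    (s : Finset {b // q b}) {f f' : ∀ b : {b // q b}, F b} (hf : ∀ b ∈ s, f b ≠ f' b) :
    uniformProb (fun h : ∀ b, F b → Y b => ∀ b ∈ s, h b (f b) = h b (f' b)) ≤
      ∏ b ∈ s, (Fintype.card (Y b) : ℝ)⁻¹ := by
  -- The random functions are indexed by all of `B`, but the two points are given only on the
  -- subtype, hence the quantification over proofs of `q b`.
  have key := uniformProb_forall_mem_le (Ω := fun b => F b → Y b)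
    (s.map (Function.Embedding.subtype q))
    fun b h => ∀ hb : q b, ⟨b, hb⟩ ∈ s → h (f ⟨b, hb⟩) = h (f' ⟨b, hb⟩)
  rw [Finset.prod_map] at key
  refine (uniformProb_mono fun h hh b _ hb hbs => hh ⟨b, hb⟩ hbs).trans (key.trans ?_)
  refine Finset.prod_le_prod (fun _ _ => uniformProb_nonneg _) fun b hb => ?_
  exact (uniformProb_mono fun h hh => hh b.2 hb).trans (uniformProb_collision_le (hf b hb))

/-- The codebooks carry maps for all groups at once; only those of one group `a` matter here. -/
lemma uniformProb_collisions_apply_le {A B : Type*} [Fintype A] [DecidableEq A] [Fintype B]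
    [DecidableEq B] (a : A) {F Y : A → B → Type*} [∀ a b, Fintype (F a b)]
    [∀ a b, DecidableEq (F a b)] [∀ a b, Fintype (Y a b)] {q : B → Prop}
    (s : Finset {b // q b}) {f f' : ∀ b : {b // q b}, F a b} (hf : ∀ b ∈ s, f b ≠ f' b) :
    uniformProb (fun h : ∀ a b, F a b → Y a b => ∀ b ∈ s, h a b (f b) = h a b (f' b)) ≤
      ∏ b ∈ s, (Fintype.card (Y a b) : ℝ)⁻¹ :=
  (uniformProb_eval_le (Ω := fun a => ∀ b, F a b → Y a b) a
    fun h => ∀ b ∈ s, h b (f b) = h b (f' b)).trans (uniformProb_collisions_le s hf)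

open scoped Classical in
/-- Union bound for random binning: a family `x` is binned by random functions `h ω b`, the bin `b`
depending on the coordinates `ι b u` of `x` only. This bounds the probability that some other family,
equal to `x` on `A`, is in the same bins as `x`. -/
theorem uniformProb_exists_same_bins_le {Ω V B : Type*} [Fintype Ω] [Fintype V] [Fintype B]
    {X : V → Type*} [∀ v, Fintype (X v)] {U : B → Type*} (ι : ∀ b, U b → V)
    {Y : B → Type*} [∀ b, Fintype (Y b)] (h : Ω → ∀ b, (∀ u : U b, X (ι b u)) → Y b)
    (hcoll : ∀ (s : Finset B) (f f' : ∀ b, ∀ u : U b, X (ι b u)), (∀ b ∈ s, f b ≠ f' b) →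
      uniformProb (fun ω => ∀ b ∈ s, h ω b (f b) = h ω b (f' b)) ≤
        ∏ b ∈ s, (Fintype.card (Y b) : ℝ)⁻¹)
    (x : ∀ v, X v) (A : Set V) :
    uniformProb (fun ω => ∃ x' : ∀ v, X v, x' ≠ x ∧ (∀ v ∈ A, x' v = x v) ∧
        ∀ b, h ω b (fun u => x' (ι b u)) = h ω b (fun u => x (ι b u))) ≤
      ∑ T : Finset V with T.Nonempty ∧ ∀ v ∈ T, v ∉ A,
        (∏ v ∈ T, (Fintype.card (X v) : ℝ)) *
          ∏ b with ∃ u, ι b u ∈ T, (Fintype.card (Y b) : ℝ)⁻¹ := by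
  -- The union bound runs over the set of coordinates in which `x'` differs from `x`, which is
  -- nonempty and disjoint from `A`.
  let diff : (∀ v, X v) → Finset V := fun x' => Finset.univ.filter fun v => x' v ≠ x v
  refine (uniformProb_mono (q := fun ω => ∃ T ∈ (Finset.univ.filter fun T : Finset V =>
    T.Nonempty ∧ ∀ v ∈ T, v ∉ A), ∃ x' ∈ (Finset.univ.filter fun x' => diff x' = T),
      ∀ b ∈ (Finset.univ.filter fun b => ∃ u, ι b u ∈ T),
        h ω b (fun u => x' (ι b u)) = h ω b (fun u => x (ι b u))) ?_).trans
    ((uniformProb_exists_le _ _).trans (Finset.sum_le_sum fun T hT => ?_))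
  · rintro ω ⟨x', hne, hA, hb⟩
    refine ⟨diff x', ?_, x', by simp, fun b _ => hb b⟩
    obtain ⟨v, hv⟩ := Function.ne_iff.1 hne
    simp only [Finset.mem_filter, Finset.mem_univ, true_and, diff]
    exact ⟨⟨v, by simpa using hv⟩, fun v hv hvA => hv (hA v hvA)⟩
  · refine (uniformProb_exists_le _ _).trans ?_
    refine (Finset.sum_le_card_nsmul _ _
      (∏ b with ∃ u, ι b u ∈ T, (Fintype.card (Y b) : ℝ)⁻¹) fun x' hx' => ?_).trans ?_
    -- Only bins that see a coordinate of `T` are kept; their inputs really differ, so collisions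
    -- are unlikely.
    · refine hcoll _ (fun b u => x' (ι b u)) (fun b u => x (ι b u)) fun b hb => ?_
      obtain ⟨u, hu⟩ := (Finset.mem_filter.1 hb).2
      rw [← (Finset.mem_filter.1 hx').2] at hu
      exact Function.ne_iff.2 ⟨u, (Finset.mem_filter.1 hu).2⟩
    · rw [nsmul_eq_mul]
      refine mul_le_mul_of_nonneg_right ?_ (by positivity)
      -- A family that agrees with `x` off `T` is determined by its restriction to `T`.
      have hc : (Finset.univ.filter fun x' => diff x' = T).card ≤
          (Finset.univ : Finset (∀ v : T, X v)).card := by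
        refine Finset.card_le_card_of_injOn (fun x' v => x' v) (by simp) ?_
        intro y hy z hz hyz
        have hy : diff y = T := by simpa using hy
        have hz : diff z = T := by simpa using hz
        ext v
        by_cases hv : v ∈ T
        · exact congrFun hyz ⟨v, hv⟩
        · have h1 : y v = x v := by
            by_contra h'; exact hv (hy ▸ by simpa [diff] using h')
          have h2 : z v = x v := by
            by_contra h'; exact hv (hz ▸ by simpa [diff] using h')
          rw [h1, h2]
      rw [Finset.card_univ, Fintype.card_pi, Finset.prod_coe_sort T fun v => Fintype.card (X v)]
        at hc
      exact_mod_cast hc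

/-- If the rates `a` of some families have a smaller sum than the rates `b` of the bins, then the
number of families times the probability of hitting the given bins vanishes. -/
lemma tendsto_prod_mul_prod_inv {V B : Type*} (T : Finset V) (s : Finset B) (a : V → ℝ) (b : B → ℝ)
    {k : V → ℕ → ℕ} (hk : ∀ v ∈ T, ∀ n : ℕ, (k v n : ℝ) ≤ n * a v + 1)
    (hab : ∑ v ∈ T, a v < ∑ i ∈ s, b i) :
    Tendsto (fun n : ℕ => (∏ v ∈ T, (Fintype.card (Fin (2 ^ k v n)) : ℝ)) *
      ∏ i ∈ s, (Fintype.card (IdxSet n (b i)) : ℝ)⁻¹) atTop (𝓝 0) := by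
  set δ := ∑ i ∈ s, b i - ∑ v ∈ T, a v with hδ
  have hδ0 : 0 < δ := by linarith
  -- Rounding costs at most one bit per factor, which gives the constant; the rest decays as
  -- 2^(-δn).
  have hlim : Tendsto (fun n : ℕ => (2 : ℝ) ^ ((T.card + s.card : ℝ)) * ((2 : ℝ) ^ (-δ)) ^ n) atTop
      (𝓝 0) := by
    rw [← mul_zero ((2 : ℝ) ^ ((T.card + s.card : ℝ)))]
    refine Tendsto.const_mul _ (tendsto_pow_atTop_nhds_zero_of_lt_one (by positivity) ?_)
    exact Real.rpow_lt_one_of_one_lt_of_neg (by norm_num) (by linarith)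
  refine squeeze_zero (fun n => by positivity) (fun n => ?_) hlim
  have h1 : ∏ v ∈ T, (Fintype.card (Fin (2 ^ k v n)) : ℝ) ≤
      (2 : ℝ) ^ (∑ v ∈ T, (n * a v + 1)) := by
    rw [Real.rpow_sum_of_pos (by norm_num)]
    refine Finset.prod_le_prod (fun _ _ => by positivity) fun v hv => ?_
    rw [Fintype.card_fin]
    push_cast
    rw [← Real.rpow_natCast]
    exact Real.rpow_le_rpow_of_exponent_le (by norm_num) (hk v hv n)
  have h2 : ∏ i ∈ s, (Fintype.card (IdxSet n (b i)) : ℝ)⁻¹ ≤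
      (2 : ℝ) ^ (∑ i ∈ s, (1 - n * b i)) := by
    rw [Real.rpow_sum_of_pos (by norm_num)]
    refine Finset.prod_le_prod (fun _ _ => by positivity) fun i _ => ?_
    rw [Fintype.card_fin]
    push_cast
    rw [← Real.rpow_natCast, ← Real.rpow_neg (by norm_num)]
    refine Real.rpow_le_rpow_of_exponent_le (by norm_num) ?_
    have := Nat.lt_floor_add_one ((n : ℝ) * b i)
    linarith
  refine (mul_le_mul h1 h2 (by positivity) (by positivity)).trans (le_of_eq ?_)
  rw [← Real.rpow_add (by norm_num), ← Real.rpow_natCast, ← Real.rpow_mul (by norm_num),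
    ← Real.rpow_add (by norm_num)]
  congr 1
  simp only [Finset.sum_add_distrib, Finset.sum_sub_distrib, ← Finset.mul_sum, Finset.sum_const,
    nsmul_eq_mul, mul_one, hδ]
  ring

/-! ### Membership in groups, and error probability as a uniform probability -/

namespace IndexCodingProblem

variable {N K : ℕ} {I : IndexCodingProblem N K}

lemma mem_groupMsgs_of_mem_composites {P : Finset (Fin K)} {J : Finset (Fin N)}
    (hJ : J ∈ I.composites P) {i : Fin N} (hi : i ∈ J) : i ∈ I.groupMsgs P := by
  obtain ⟨k, hk, hJk⟩ := Finset.mem_biUnion.1 hJ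
  exact I.mem_groupMsgs hk (Finset.mem_powerset.1 hJk hi)

lemma union_groupSide_subset {P : Finset (Fin K)} (D : I.DecodingChoice P) {j : Fin N}
    (hj : j ∈ I.groupMsgs P) {i : Fin N} (hi : i ∈ D.D j ∪ I.groupSide P j) :
    i ∈ I.groupMsgs P := by
  rcases Finset.mem_union.1 hi with h | h
  · exact (Finset.mem_sdiff.1 (D.subset j hj h)).1
  · exact (Finset.mem_inter.1 h).2

lemma composites_mono {S T : Finset (Fin K)} (h : S ⊆ T) : I.composites S ⊆ I.composites T :=
  Finset.biUnion_subset_biUnion_of_subset_left _ h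

lemma IndexCode.errorProb_eq_uniformProb {n : ℕ} {R : Fin N → ℝ} (c : I.IndexCode n R) :
    c.errorProb = uniformProb fun m => ∃ j, c.estimate m j ≠ m j := by
  unfold IndexCode.errorProb uniformProb
  congr!

lemma IndexCode.errorProb_nonneg {n : ℕ} {R : Fin N → ℝ} (c : I.IndexCode n R) :
    0 ≤ c.errorProb := by
  rw [IndexCode.errorProb_eq_uniformProb]
  exact uniformProb_nonneg _

namespace CompositeCode

variable {Q : Finset (Finset (Fin K))} {c : Finset (Fin K) → Fin K → ℝ}
  {γ : Finset (Fin K) → Finset (Fin N) → ℝ} {r : Finset (Fin K) → Fin N → ℝ} {n : ℕ}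

/-! ### Correct decoding -/

/-- The side information of receiver `j` when the sub-messages of the group `P` are `x`. -/
def sideOf {P : Finset (Fin K)} (x : ∀ i, i ∈ I.groupMsgs P → MsgSet n (r P i)) (j : Fin N)
    (i : {i // i ∈ I.groupSide P j}) : MsgSet n (r P i) :=
  x i (Finset.mem_inter.1 i.2).2

/-- The composite indices when the sub-messages of the group `P` are `x`. -/
def indicesOf (X : I.CompositeCode Q c γ r n) {P : Finset (Fin K)}
    (x : ∀ i, i ∈ I.groupMsgs P → MsgSet n (r P i)) (J : {J // J ∈ I.composites P}) :
    IdxSet n (γ P J) :=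
  X.comp P J fun i => x i (mem_groupMsgs_of_mem_composites J.2 i.2)

/-- The first decoding step is ambiguous at receiver `j`. -/
def IndicesAmbiguous (X : I.CompositeCode Q c γ r n) (P : Finset (Fin K)) (j : Fin N)
    (x : ∀ i, i ∈ I.groupMsgs P → MsgSet n (r P i)) : Prop :=
  ∃ w, w ≠ X.indicesOf x ∧ X.IndicesCompatible P j
    (fun k => X.bin P k fun J => X.indicesOf x ⟨J, I.mem_composites k.2 J.2⟩) (sideOf x j) w

/-- The second decoding step is ambiguous at receiver `j`. -/
def MessagesAmbiguous (X : I.CompositeCode Q c γ r n) {P : Finset (Fin K)} (D : I.DecodingChoice P)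
    {j : Fin N} (hj : j ∈ I.groupMsgs P) (x : ∀ i, i ∈ I.groupMsgs P → MsgSet n (r P i)) : Prop :=
  ∃ y, y ≠ (fun i : {i // i ∈ D.D j ∪ I.groupSide P j} => x i (union_groupSide_subset D hj i.2)) ∧
    X.MessagesCompatible P j (D.D j) (sideOf x j) (X.indicesOf x) y

/-- The true tuple is always compatible, so without ambiguity it is the unique one. The same reason
gives `decodeMessage_eq`. -/
lemma decodeIndices_eq {X : I.CompositeCode Q c γ r n} {P : Finset (Fin K)} {j : Fin N}
    {x : ∀ i, i ∈ I.groupMsgs P → MsgSet n (r P i)} (h : ¬ X.IndicesAmbiguous P j x) :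
    X.decodeIndices P j (fun k => X.bin P k fun J => X.indicesOf x ⟨J, I.mem_composites k.2 J.2⟩)
      (sideOf x j) = X.indicesOf x := by
  have hex : ∃! w, X.IndicesCompatible P j
      (fun k => X.bin P k fun J => X.indicesOf x ⟨J, I.mem_composites k.2 J.2⟩) (sideOf x j) w := by
    refine ⟨X.indicesOf x, ⟨fun k => rfl, fun J hJ => rfl⟩, fun w hw => ?_⟩
    by_contra hne
    exact h ⟨w, hne, hw⟩
  rw [decodeIndices, dif_pos hex]
  by_contra hne
  exact h ⟨_, hne, hex.choose_spec.1⟩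

lemma decodeMessage_eq {X : I.CompositeCode Q c γ r n} {P : Finset (Fin K)}
    {D : I.DecodingChoice P} {j : Fin N} {hj : j ∈ I.groupMsgs P}
    {x : ∀ i, i ∈ I.groupMsgs P → MsgSet n (r P i)} (h : ¬ X.MessagesAmbiguous D hj x) :
    X.decodeMessage P j (D.D j) (D.mem j hj) (sideOf x j) (X.indicesOf x) = x j hj := by
  have hex : ∃! y, X.MessagesCompatible P j (D.D j) (sideOf x j) (X.indicesOf x) y := by
    refine ⟨fun i => x i (union_groupSide_subset D hj i.2), ⟨fun i => rfl, fun J hJ => rfl⟩,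
      fun w hw => ?_⟩
    by_contra hne
    exact h ⟨w, hne, hw⟩
  rw [decodeMessage, dif_pos hex]
  have : hex.choose = fun i : {i // i ∈ D.D j ∪ I.groupSide P j} =>
      x i (union_groupSide_subset D hj i.2) := by
    by_contra hne
    exact h ⟨_, hne, hex.choose_spec.1⟩
  rw [this]

/-- The sub-messages of the group `P` when the messages are `m`. -/
def subMessages (X : I.CompositeCode Q c γ r n) (m : ∀ j, MsgSet n (I.totalRate Q r j))
    {P : Finset (Fin K)} (hP : P ∈ Q) (i : Fin N) (hi : i ∈ I.groupMsgs P) : MsgSet n (r P i) :=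
  X.split i (m i) ⟨P, hP, hi⟩

/-- Without ambiguity the first step returns the true composite indices, so the second step runs on
correct input, and `merge` undoes `split`. -/
lemma estimate_eq {X : I.CompositeCode Q c γ r n} {D : ∀ P, I.DecodingChoice P}
    {m : ∀ j, MsgSet n (I.totalRate Q r j)} {j : Fin N}
    (h : ∀ P (hP : P ∈ Q) (hj : j ∈ I.groupMsgs P),
      ¬ X.IndicesAmbiguous P j (X.subMessages m hP) ∧
        ¬ X.MessagesAmbiguous (D P) hj (X.subMessages m hP)) :
    (X.toIndexCode D).estimate m j = m j := by
  refine Eq.trans ?_ (X.merge_split j (m j))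
  refine congrArg (X.merge j) (funext fun P => ?_)
  obtain ⟨h1, h2⟩ := h P P.2.1 P.2.2
  have h3 := decodeMessage_eq h2
  rw [← decodeIndices_eq h1] at h3
  refine Eq.trans ?_ h3
  change X.decodeMessage P j _ _ _ (X.decodeIndices P j
    (fun k => X.demux k (X.mux k (X.binIndex k fun i => m i)) ⟨P, P.2.1, k.2⟩) _) = _
  simp only [X.demux_mux]
  rfl

/-! ### Random codebooks -/

/-- The maps that bin the composite messages. -/
abbrev CompMaps (γ : Finset (Fin K) → Finset (Fin N) → ℝ) (r : Finset (Fin K) → Fin N → ℝ)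
    (n : ℕ) : Type :=
  ∀ (P : Finset (Fin K)) (J : Finset (Fin N)),
    (∀ i : {i // i ∈ J}, MsgSet n (r P i)) → IdxSet n (γ P J)

variable (I) in
/-- The maps that bin the composite indices at the senders. -/
abbrev BinMaps (c : Finset (Fin K) → Fin K → ℝ) (γ : Finset (Fin K) → Finset (Fin N) → ℝ)
    (n : ℕ) : Type :=
  ∀ (P : Finset (Fin K)) (k : Fin K),
    (∀ J : {J // J ⊆ I.S k}, IdxSet n (γ P J)) → IdxSet n (c P k)

/-- The code `X` with other composite and bin maps. -/
def withMaps (X : I.CompositeCode Q c γ r n)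
    (comp : CompMaps γ r n)
    (bin : BinMaps I c γ n) :
    I.CompositeCode Q c γ r n :=
  { X with comp := comp, bin := bin }

open scoped Classical in
variable (I) in
/-- The union bound on the probability that the first decoding step is ambiguous. -/
def indicesBound (c : Finset (Fin K) → Fin K → ℝ) (γ : Finset (Fin K) → Finset (Fin N) → ℝ)
    (P : Finset (Fin K)) (j : Fin N) (n : ℕ) : ℝ :=
  ∑ T : Finset {J // J ∈ I.composites P} with T.Nonempty ∧ ∀ J ∈ T, ¬ J.1 ⊆ I.groupSide P j,
    (∏ J ∈ T, (Fintype.card (IdxSet n (γ P J)) : ℝ)) *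
      ∏ k ∈ Finset.univ.filter fun k : {k // k ∈ P} =>
          ∃ J : {J // J ⊆ I.S k}, ⟨J.1, I.mem_composites k.2 J.2⟩ ∈ T,
        (Fintype.card (IdxSet n (c P k)) : ℝ)⁻¹

/-- The binning bound with composite indices as coordinates and senders as bins; composites inside
the side information are the known coordinates. The composite maps stay fixed. -/
lemma uniformProb_indicesAmbiguous_le (X : I.CompositeCode Q c γ r n)
    (comp : CompMaps γ r n)
    (P : Finset (Fin K)) (j : Fin N) (x : ∀ i, i ∈ I.groupMsgs P → MsgSet n (r P i)) :
    uniformProb (fun bin => (X.withMaps comp bin).IndicesAmbiguous P j x) ≤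
      indicesBound I c γ P j n := by
  have key := uniformProb_exists_same_bins_le (V := {J // J ∈ I.composites P})
    (B := {k // k ∈ P}) (X := fun J => IdxSet n (γ P J)) (U := fun k => {J // J ⊆ I.S k.1})
    (fun k J => ⟨J.1, I.mem_composites k.2 J.2⟩) (Y := fun k => IdxSet n (c P k))
    (fun (bin : BinMaps I c γ n) k => bin P k)
    (fun s f f' hf => uniformProb_collisions_apply_le
      (F := fun P k => ∀ J : {J // J ⊆ I.S k}, IdxSet n (γ P J)) (Y := fun P k => IdxSet n (c P k))
      P s hf)
    (fun J => comp P J fun i => x i (mem_groupMsgs_of_mem_composites J.2 i.2))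
    {J | J.1 ⊆ I.groupSide P j}
  refine (uniformProb_mono ?_).trans (key.trans (le_of_eq ?_))
  · rintro bin ⟨w, hne, hb, hA⟩
    exact ⟨w, hne, fun J hJ => (hA J hJ).symm, hb⟩
  · simp only [indicesBound, Set.mem_ofPred_eq]
    congr!

/-- Let `s` be the senders in `P` that hold some composite in `T`. No sender of `P` outside `s`
holds any of them, so `T` lies in the index set of (b) for the sender set `s`. As `γ` is nonnegative
on the composites of `P`, (b) bounds its sum over `T`. -/
lemma tendsto_indicesBound {P : Finset (Fin K)} {j : Fin N} (hj : j ∈ I.groupMsgs P)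
    (hγ : ∀ J ∈ I.composites P, 0 ≤ γ P J) (h : I.CompositeConstraints P (c P) (γ P)) :
    Tendsto (indicesBound I c γ P j) atTop (𝓝 0) := by
  classical
  rw [← Finset.sum_const_zero (ι := Finset {J // J ∈ I.composites P})]
  refine tendsto_finsetSum _ fun T hT => ?_
  obtain ⟨hTne, hTA⟩ := (Finset.mem_filter.1 hT).2
  set s : Finset {k // k ∈ P} := Finset.univ.filter fun k =>
    ∃ J : {J // J ⊆ I.S k}, ⟨J.1, I.mem_composites k.2 J.2⟩ ∈ T with hs
  refine tendsto_prod_mul_prod_inv T s (fun J => γ P J) (fun k => c P k)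
    (k := fun J n => ⌊(n : ℝ) * γ P J⌋₊) (fun J _ n => ?_) ?_
  · have := Nat.floor_le (mul_nonneg (Nat.cast_nonneg n) (hγ J J.2))
    linarith
  have hsP : s.map (Function.Embedding.subtype _) ⊆ P := fun k hk => by
    obtain ⟨k', _, rfl⟩ := Finset.mem_map.1 hk
    exact k'.2
  have hmem : ∀ J ∈ T, ∀ k (hk : k ∈ P), J.1 ⊆ I.S k → k ∈ s.map (Function.Embedding.subtype _) := by
    intro J hJ k hk hJk
    refine Finset.mem_map.2 ⟨⟨k, hk⟩, ?_, rfl⟩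
    exact Finset.mem_filter.2 ⟨Finset.mem_univ _, ⟨J.1, hJk⟩, hJ⟩
  have hsender : ∀ J : {J // J ∈ I.composites P}, ∃ k ∈ P, J.1 ⊆ I.S k := fun J => by
    obtain ⟨k, hk, hJk⟩ := Finset.mem_biUnion.1 J.2
    exact ⟨k, hk, Finset.mem_powerset.1 hJk⟩
  have hsne : (s.map (Function.Embedding.subtype _)).Nonempty := by
    obtain ⟨J, hJ⟩ := hTne
    obtain ⟨k, hk, hJk⟩ := hsender J
    exact ⟨k, hmem J hJ k hk hJk⟩
  have hlt := h j hj _ hsP hsne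
  rw [Finset.sum_map] at hlt
  refine lt_of_le_of_lt ?_ hlt
  refine (Finset.sum_map T (Function.Embedding.subtype _) (γ P)).symm.le.trans ?_
  refine Finset.sum_le_sum_of_subset_of_nonneg (fun J hJ => ?_) fun J hJ _ =>
    hγ J (composites_mono hsP (Finset.mem_filter.1 hJ).1)
  obtain ⟨J, hJT, rfl⟩ := Finset.mem_map.1 hJ
  obtain ⟨k, hk, hJk⟩ := hsender J
  refine Finset.mem_filter.2 ⟨I.mem_composites (hmem J hJT k hk hJk) hJk, fun hJ' => ?_, hTA J hJT⟩
  obtain ⟨k', hk', hJk'⟩ := Finset.mem_biUnion.1 hJ'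
  rw [Finset.mem_sdiff] at hk'
  exact hk'.2 (hmem J hJT k' hk'.1 (Finset.mem_powerset.1 hJk'))

open scoped Classical in
/-- The union bound on the probability that the second decoding step is ambiguous. -/
def messagesBound (γ : Finset (Fin K) → Finset (Fin N) → ℝ) (r : Finset (Fin K) → Fin N → ℝ)
    {P : Finset (Fin K)} (D : I.DecodingChoice P) (j : Fin N) (n : ℕ) : ℝ :=
  ∑ T : Finset {i // i ∈ D.D j ∪ I.groupSide P j} with
      T.Nonempty ∧ ∀ i ∈ T, i.1 ∉ I.groupSide P j,
    (∏ i ∈ T, (Fintype.card (MsgSet n (r P i)) : ℝ)) *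
      ∏ J ∈ Finset.univ.filter fun J : {J // J ∈ I.composites P ∧ J ⊆ D.D j ∪ I.groupSide P j} =>
          ∃ i : {i // i ∈ J.1}, ⟨i.1, J.2.2 i.2⟩ ∈ T,
        (Fintype.card (IdxSet n (γ P J)) : ℝ)⁻¹

/-- The same binning bound one layer up: sub-messages are the coordinates, composite indices within
`D ∪ A` are the bins, and now the bin maps stay fixed. -/
lemma uniformProb_messagesAmbiguous_le (X : I.CompositeCode Q c γ r n)
    (bin : BinMaps I c γ n)
    {P : Finset (Fin K)} (D : I.DecodingChoice P) {j : Fin N} (hj : j ∈ I.groupMsgs P)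
    (x : ∀ i, i ∈ I.groupMsgs P → MsgSet n (r P i)) :
    uniformProb (fun comp => (X.withMaps comp bin).MessagesAmbiguous D hj x) ≤
      messagesBound γ r D j n := by
  have hcoll : ∀ (s : Finset {J // J ∈ I.composites P ∧ J ⊆ D.D j ∪ I.groupSide P j})
      (f f' : ∀ J : {J // J ∈ I.composites P ∧ J ⊆ D.D j ∪ I.groupSide P j},
        ∀ i : {i // i ∈ J.1}, MsgSet n (r P i)), (∀ J ∈ s, f J ≠ f' J) →
      uniformProb (fun comp : CompMaps γ r n =>
        ∀ J ∈ s, comp P J.1 (f J) = comp P J.1 (f' J)) ≤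
        ∏ J ∈ s, (Fintype.card (IdxSet n (γ P J)) : ℝ)⁻¹ := by
    intro s f f' hf
    have := uniformProb_collisions_apply_le
      (F := fun P J => ∀ i : {i // i ∈ J}, MsgSet n (r P i)) (Y := fun P J => IdxSet n (γ P J))
      P s hf
    exact this
  have key := uniformProb_exists_same_bins_le (V := {i // i ∈ D.D j ∪ I.groupSide P j})
    (B := {J // J ∈ I.composites P ∧ J ⊆ D.D j ∪ I.groupSide P j})
    (X := fun i => MsgSet n (r P i)) (U := fun J => {i // i ∈ J.1})
    (fun J i => ⟨i.1, J.2.2 i.2⟩) (Y := fun J => IdxSet n (γ P J))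
    (fun (comp : CompMaps γ r n) J => comp P J)
    hcoll
    (fun i => x i (union_groupSide_subset D hj i.2)) {i | i.1 ∈ I.groupSide P j}
  refine (uniformProb_mono ?_).trans (key.trans (le_of_eq ?_))
  · rintro comp ⟨y, hne, hA, hb⟩
    exact ⟨y, hne, fun i hi => hA ⟨i.1, hi⟩, fun J => hb ⟨J.1, J.2.1⟩ J.2.2⟩
  · simp only [messagesBound, Set.mem_ofPred_eq]
    congr!

/-- Wrong coordinates avoid the side information, so `T` lies in the decoding set, and the bins that
see `T` are exactly the composites summed in (a). -/
lemma tendsto_messagesBound {P : Finset (Fin K)} {D : I.DecodingChoice P} {j : Fin N}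
    (hj : j ∈ I.groupMsgs P) (hr : ∀ i ∈ I.groupMsgs P, 0 ≤ r P i)
    (h : I.MessageConstraints P D (γ P) (r P)) :
    Tendsto (messagesBound γ r D j) atTop (𝓝 0) := by
  classical
  rw [← Finset.sum_const_zero (ι := Finset {i // i ∈ D.D j ∪ I.groupSide P j})]
  refine tendsto_finsetSum _ fun T hT => ?_
  obtain ⟨hTne, hTA⟩ := (Finset.mem_filter.1 hT).2
  refine tendsto_prod_mul_prod_inv T _ (fun i => r P i)
    (fun J : {J // J ∈ I.composites P ∧ J ⊆ D.D j ∪ I.groupSide P j} => γ P J)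
    (k := fun i n => ⌈(n : ℝ) * r P i⌉₊) (fun i _ n => ?_) ?_
  · exact (Nat.ceil_lt_add_one (mul_nonneg (Nat.cast_nonneg n)
      (hr i (union_groupSide_subset D hj i.2)))).le
  have hTD : T.map (Function.Embedding.subtype _) ⊆ D.D j := fun i hi => by
    obtain ⟨i, hiT, rfl⟩ := Finset.mem_map.1 hi
    exact (Finset.mem_union.1 i.2).resolve_right (hTA i hiT)
  have hlt := h j hj _ hTD (hTne.map)
  rw [Finset.sum_map] at hlt
  refine hlt.trans_le (le_of_eq ?_)
  refine Eq.trans ?_ (Finset.sum_map _ (Function.Embedding.subtype _) (γ P))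
  refine Finset.sum_congr ?_ fun _ _ => rfl
  ext J
  simp only [Finset.mem_filter, Finset.mem_map, Finset.mem_univ, true_and]
  constructor
  · rintro ⟨hJ, hJD, i, hi⟩
    obtain ⟨hiJ, hiT⟩ := Finset.mem_inter.1 hi
    obtain ⟨i', hi'T, rfl⟩ := Finset.mem_map.1 hiT
    exact ⟨⟨J, hJ, hJD⟩, ⟨⟨i'.1, hiJ⟩, hi'T⟩, rfl⟩
  · rintro ⟨J, ⟨i, hi⟩, rfl⟩
    exact ⟨J.2.1, J.2.2, i.1, Finset.mem_inter.2 ⟨i.2, Finset.mem_map.2 ⟨_, hi, rfl⟩⟩⟩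

/-! ### Rate splitting and multiplexing -/

/-- Only cardinalities matter. Rounding message sizes up and index sizes down points the right way:
a ceiling of a sum is at most the sum of ceilings, and a sum of floors is at most the floor of the
sum. -/
lemma nonempty_of_links (hc : I.AdmissibleLinks Q c) : Nonempty (I.CompositeCode Q c γ r n) := by
  have hsplit : ∀ j, ∃ (f : MsgSet n (I.totalRate Q r j) →
      ∀ P : {P // P ∈ Q ∧ j ∈ I.groupMsgs P}, MsgSet n (r P j)) (g : _), Function.LeftInverse g f := by
    intro j
    refine exists_leftInverse_of_card_le ?_
    rw [Fintype.card_pi, Fintype.card_fin]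
    simp only [Fintype.card_fin]
    rw [Finset.prod_pow_eq_pow_sum]
    refine Nat.pow_le_pow_right (by norm_num) (Nat.ceil_le.2 ?_)
    rw [totalRate, Finset.sum_subtype (p := fun P => P ∈ Q ∧ j ∈ I.groupMsgs P) _ (by simp)]
    push_cast
    rw [Finset.mul_sum]
    exact Finset.sum_le_sum fun P _ => Nat.le_ceil _
  have hmux : ∀ k, ∃ (f : (∀ P : {P // P ∈ Q ∧ k ∈ P}, IdxSet n (c P k)) → IdxSet n (I.C k))
      (g : _), Function.LeftInverse g f := by
    intro k
    refine exists_leftInverse_of_card_le ?_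
    rw [Fintype.card_pi, Fintype.card_fin]
    simp only [Fintype.card_fin]
    rw [Finset.prod_pow_eq_pow_sum]
    refine Nat.pow_le_pow_right (by norm_num) (Nat.le_floor ?_)
    refine le_trans ?_ (mul_le_mul_of_nonneg_left (hc.2 k) (Nat.cast_nonneg n))
    rw [Finset.sum_subtype (p := fun P => P ∈ Q ∧ k ∈ P) _ (by simp)]
    push_cast
    rw [Finset.mul_sum]
    exact Finset.sum_le_sum fun P _ => Nat.floor_le
      (mul_nonneg (Nat.cast_nonneg n) (hc.1 P P.2.1 k P.2.2).le)
  choose f g hfg using hsplit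
  choose u v huv using hmux
  -- The constant composite and bin maps are placeholders, replaced later through `withMaps`.
  exact ⟨⟨f, g, hfg, fun _ _ _ => 0, fun _ _ _ => 0, u, v, huv⟩⟩

/-! ### Reliability -/

/-- Some choice of composite and bin maps achieves the average over all such choices. -/
lemma exists_errorProb_le (X₀ : I.CompositeCode Q c γ r n) (D : ∀ P, I.DecodingChoice P) :
    ∃ X : I.CompositeCode Q c γ r n, (X.toIndexCode D).errorProb ≤
      ∑ P ∈ Q, ∑ j ∈ I.groupMsgs P, (indicesBound I c γ P j n + messagesBound γ r (D P) j n) := by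
  classical
  have hb1 : ∀ P j, 0 ≤ indicesBound I c γ P j n := fun P j =>
    Finset.sum_nonneg fun _ _ => by positivity
  have hb2 : ∀ P j, 0 ≤ messagesBound γ r (D P) j n := fun P j =>
    Finset.sum_nonneg fun _ _ => by positivity
  have hb0 : 0 ≤ ∑ P ∈ Q, ∑ j ∈ I.groupMsgs P,
      (indicesBound I c γ P j n + messagesBound γ r (D P) j n) :=
    Finset.sum_nonneg fun P _ => Finset.sum_nonneg fun j _ => add_nonneg (hb1 P j) (hb2 P j)
  have hprob : ∀ m : (∀ j, MsgSet n (I.totalRate Q r j)),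
      uniformProb (fun q : (CompMaps γ r n) ×
      (BinMaps I c γ n) =>
        ∃ j, ((X₀.withMaps q.1 q.2).toIndexCode D).estimate m j ≠ m j) ≤
      ∑ P ∈ Q, ∑ j ∈ I.groupMsgs P, (indicesBound I c γ P j n + messagesBound γ r (D P) j n) := by
    intro m
    refine (uniformProb_mono (q := fun q => ∃ P ∈ Q.attach, ∃ j ∈ (I.groupMsgs P.1).attach,
      ((X₀.withMaps q.1 q.2).IndicesAmbiguous P.1 j (X₀.subMessages m P.2) ∨
        (X₀.withMaps q.1 q.2).MessagesAmbiguous (D P.1) j.2 (X₀.subMessages m P.2)))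
          ?_).trans ?_
    · rintro ⟨comp, bin⟩ ⟨j, hj⟩
      by_contra! hno
      exact hj (estimate_eq fun P hP hjP =>
        hno ⟨P, hP⟩ (Finset.mem_attach _ _) ⟨j, hjP⟩ (Finset.mem_attach _ _))
    · rw [← Finset.sum_attach Q]
      refine (uniformProb_exists_le _ _).trans (Finset.sum_le_sum fun P _ => ?_)
      rw [← Finset.sum_attach (I.groupMsgs P.1)]
      refine (uniformProb_exists_le _ _).trans (Finset.sum_le_sum fun j _ => ?_)
      refine (uniformProb_or_le _ _).trans (add_le_add ?_ ?_)
      -- Each decoding step uses the randomness of one layer, conditionally on the other.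
      · exact uniformProb_prod_le (hb1 _ _) fun comp =>
          uniformProb_indicesAmbiguous_le X₀ comp P j _
      · exact uniformProb_prod_le' (hb2 _ _) fun bin =>
          uniformProb_messagesAmbiguous_le X₀ bin (D P) j.2 _
  -- The bound is uniform in the messages, so it holds jointly over codebooks and messages, and one
  -- codebook then attains it.
  have havg := uniformProb_prod_le' (α := CompMaps γ r n × BinMaps I c γ n)
    (β := ∀ j, MsgSet n (I.totalRate Q r j))
    (p := fun q => ∃ j, ((X₀.withMaps q.1.1 q.1.2).toIndexCode D).estimate q.2 j ≠ q.2 j) hb0 hprob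
  have : Nonempty (CompMaps γ r n × BinMaps I c γ n) :=
    ⟨fun _ _ _ => 0, fun _ _ _ => 0⟩
  obtain ⟨⟨comp, bin⟩, h⟩ := exists_uniformProb_le havg
  refine ⟨X₀.withMaps comp bin, ?_⟩
  rw [IndexCode.errorProb_eq_uniformProb]
  exact h

end CompositeCode

/-- Cooperative composite coding is reliable at all rates that satisfy the constraints of every
group. -/
theorem cccReliable_of_groupConstraints {Q : Finset (Finset (Fin K))}
    {c : Finset (Fin K) → Fin K → ℝ} (hc : I.AdmissibleLinks Q c) (D : ∀ P, I.DecodingChoice P)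
    {γ : Finset (Fin K) → Finset (Fin N) → ℝ} {r : Finset (Fin K) → Fin N → ℝ}
    (h : ∀ P ∈ Q, I.GroupConstraints P (c P) (D P) (γ P) (r P)) : I.CCCReliable Q c D γ r := by
  choose X hX using fun n => CompositeCode.exists_errorProb_le
    (CompositeCode.nonempty_of_links (γ := γ) (r := r) (n := n) hc).some D
  refine ⟨X, squeeze_zero (fun n => IndexCode.errorProb_nonneg _) hX ?_⟩
  rw [show (0 : ℝ) = ∑ P ∈ Q, ∑ j ∈ I.groupMsgs P, (0 + 0) by simp]
  refine tendsto_finsetSum _ fun P hP => tendsto_finsetSum _ fun j hj => ?_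
  obtain ⟨hr, hγ, ha, hb⟩ := h P hP
  exact (CompositeCode.tendsto_indicesBound hj hγ hb).add
    (CompositeCode.tendsto_messagesBound hj hr ha)

/-! ### The region of a family of sender groups -/

lemma Achievable.of_mem_regionOfGroups {Q : Finset (Finset (Fin K))} {R : Fin N → ℝ}
    (hR : R ∈ I.regionOfGroups Q) : I.Achievable R := by
  classical
  obtain ⟨c, hc, r, hr, rfl⟩ := hR
  have hex : ∀ P, ∃ D : I.DecodingChoice P, P ∈ Q → r P ∈ I.regionOfChoice P (c P) D := by
    intro P
    by_cases hP : P ∈ Q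
    · obtain ⟨D, hD⟩ := Set.mem_iUnion.1 (hr P hP)
      exact ⟨D, fun _ => hD⟩
    -- A default for groups outside `Q`: decode only the requested message, which is never side
    -- information.
    · refine ⟨⟨fun j => {j}, fun j hj => ?_, fun j _ => Finset.mem_singleton_self j⟩,
        fun h => absurd h hP⟩
      refine Finset.singleton_subset_iff.2 (Finset.mem_sdiff.2 ⟨hj, fun h => ?_⟩)
      exact I.not_mem_A j (Finset.mem_inter.1 h).1
  choose D hD using hex
  have hγ : ∀ P, ∃ γ, P ∈ Q → I.GroupConstraints P (c P) (D P) γ (r P) := by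
    intro P
    by_cases hP : P ∈ Q
    · obtain ⟨γ, h⟩ := hD P hP
      exact ⟨γ, fun _ => h⟩
    · exact ⟨0, fun h => absurd h hP⟩
  choose γ hγ using hγ
  refine ⟨fun j => Finset.sum_nonneg fun P hP => ?_, ?_⟩
  · obtain ⟨hP, hj⟩ := Finset.mem_filter.1 hP
    exact (hγ P hP).1 j hj
  · obtain ⟨X, hX⟩ := cccReliable_of_groupConstraints hc D hγ
    exact ⟨fun n => (X n).toIndexCode D, hX⟩

/-- Only (a) involves the rates from above, and it consists of finitely many strict inequalities,
continuous in the rates. -/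
lemma GroupConstraints.eventually_add {P : Finset (Fin K)} {c : Fin K → ℝ} {D : I.DecodingChoice P}
    {γ : Finset (Fin N) → ℝ} {r : Fin N → ℝ} (h : I.GroupConstraints P c D γ r) :
    ∀ᶠ ε : ℝ in 𝓝[>] 0, I.GroupConstraints P c D γ fun i => r i + ε := by
  obtain ⟨hr, hγ, ha, hb⟩ := h
  have ha' : ∀ᶠ ε : ℝ in 𝓝[>] 0, I.MessageConstraints P D γ fun i => r i + ε := by
    refine eventually_all.2 fun j => eventually_imp_distrib_left.2 fun hj => eventually_all.2 fun T =>
      eventually_imp_distrib_left.2 fun hT => eventually_imp_distrib_left.2 fun hTne => ?_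
    have hlim : Tendsto (fun ε : ℝ => ∑ i ∈ T, (r i + ε)) (𝓝[>] 0) (𝓝 (∑ i ∈ T, r i)) :=
      tendsto_nhdsWithin_of_tendsto_nhds <|
        Continuous.tendsto' (by fun_prop) _ _ (by simp)
    exact hlim.eventually_lt_const (ha j hj T hT hTne)
  filter_upwards [ha', self_mem_nhdsWithin] with ε hε hpos
  exact ⟨fun j hj => add_nonneg (hr j hj) (le_of_lt hpos), hγ, hε, hb⟩

/-- The rate constraints are strict: there is room above every rate tuple in the region. -/
lemma exists_lt_mem_regionOfGroups {Q : Finset (Finset (Fin K))} (hQ : AdmissibleGroups Q)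
    {R : Fin N → ℝ} (hR : R ∈ I.regionOfGroups Q) :
    ∃ R' ∈ I.regionOfGroups Q, ∀ j, R j < R' j := by
  obtain ⟨c, hc, r, hr, rfl⟩ := hR
  have hev : ∀ᶠ ε : ℝ in 𝓝[>] 0, ∀ P ∈ Q, (fun i => r P i + ε) ∈ I.regionOfGroup P (c P) := by
    refine (eventually_all_finset Q).2 fun P hP => ?_
    obtain ⟨D, γ, h⟩ := Set.mem_iUnion.1 (hr P hP)
    filter_upwards [h.eventually_add] with ε hε
    exact Set.mem_iUnion.2 ⟨D, γ, hε⟩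
  obtain ⟨ε, hε, hpos⟩ := (hev.and self_mem_nhdsWithin).exists
  refine ⟨_, ⟨c, hc, fun P i => r P i + ε, hε, rfl⟩, fun j => ?_⟩
  -- Every message occurs in some group of `Q`; otherwise its total rate would be an empty sum and
  -- could not grow.
  obtain ⟨k, hk⟩ := I.S_cover j
  obtain ⟨P, hP, hkP⟩ := hQ.2 k
  refine Finset.sum_lt_sum_of_nonempty ⟨P, ?_⟩ fun P _ => lt_add_of_pos_right _ hpos
  exact Finset.mem_filter.2 ⟨hP, I.mem_groupMsgs hkP hk⟩

/-! ### Time sharing -/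

instance (n : ℕ) (R : Fin N → ℝ) : Nonempty (I.IndexCode n R) :=
  ⟨⟨fun _ _ => 0, fun _ _ _ => 0⟩⟩

/-- Concatenation of two index codes. Message bits that are not needed are fixed in the best
possible way. -/
lemma exists_concat {n₁ n₂ n : ℕ} {R₁ R₂ R : Fin N → ℝ} (c₁ : I.IndexCode n₁ R₁)
    (c₂ : I.IndexCode n₂ R₂)
    (hR : ∀ j, ⌈(n : ℝ) * R j⌉₊ ≤ ⌈(n₁ : ℝ) * R₁ j⌉₊ + ⌈(n₂ : ℝ) * R₂ j⌉₊)
    (hC : ∀ k, ⌊(n₁ : ℝ) * I.C k⌋₊ + ⌊(n₂ : ℝ) * I.C k⌋₊ ≤ ⌊(n : ℝ) * I.C k⌋₊) :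
    ∃ c : I.IndexCode n R, c.errorProb ≤ c₁.errorProb + c₂.errorProb := by
  -- The surplus bits: the two codes together may carry more than the message needs.
  let Z : Fin N → Type := fun j =>
    Fin (2 ^ (⌈(n₁ : ℝ) * R₁ j⌉₊ + ⌈(n₂ : ℝ) * R₂ j⌉₊ - ⌈(n : ℝ) * R j⌉₊))
  have he : ∀ j, Nonempty ((MsgSet n (R j) × Z j) ≃ (MsgSet n₁ (R₁ j) × MsgSet n₂ (R₂ j))) := by
    intro j
    refine ⟨Fintype.equivOfCardEq ?_⟩
    simp only [Fintype.card_prod, Fintype.card_fin, Z, ← pow_add]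
    rw [Nat.add_sub_cancel' (hR j)]
  have hu : ∀ k, ∃ (f : IdxSet n₁ (I.C k) × IdxSet n₂ (I.C k) → IdxSet n (I.C k)) (g : _),
      Function.LeftInverse g f := by
    intro k
    refine exists_leftInverse_of_card_le ?_
    simp only [Fintype.card_prod, Fintype.card_fin, ← pow_add]
    exact Nat.pow_le_pow_right (by norm_num) (hC k)
  choose u v huv using hu
  let e := fun j => (he j).some
  let code : (∀ j, Z j) → I.IndexCode n R := fun z =>
    { enc := fun k m => u k (c₁.enc k fun i => (e i (m i, z i)).1,
        c₂.enc k fun i => (e i (m i, z i)).2)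
      dec := fun j L a => ((e j).symm
        (c₁.dec j (fun k => (v k (L k)).1) fun i => (e i (a i, z i)).1,
          c₂.dec j (fun k => (v k (L k)).2) fun i => (e i (a i, z i)).2)).1 }
  -- With uniform padding, this bijection feeds each of the two codes uniform messages.
  let E : (∀ j, Z j) × (∀ j, MsgSet n (R j)) ≃
      (∀ j, MsgSet n₁ (R₁ j)) × (∀ j, MsgSet n₂ (R₂ j)) :=
    { toFun := fun q => (fun j => (e j (q.2 j, q.1 j)).1, fun j => (e j (q.2 j, q.1 j)).2)
      invFun := fun q => (fun j => ((e j).symm (q.1 j, q.2 j)).2,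
        fun j => ((e j).symm (q.1 j, q.2 j)).1)
      left_inv := fun q => by simp
      right_inv := fun q => by simp }
  have hest : ∀ z m j, (code z).estimate m j =
      ((e j).symm (c₁.estimate (E (z, m)).1 j, c₂.estimate (E (z, m)).2 j)).1 := by
    intro z m j
    simp only [IndexCode.estimate, code, huv _ _]
    rfl
  have hbound : uniformProb (fun q : (∀ j, Z j) × (∀ j, MsgSet n (R j)) =>
      ∃ j, (code q.1).estimate q.2 j ≠ q.2 j) ≤ c₁.errorProb + c₂.errorProb := by
    refine (uniformProb_mono (q := fun q => (∃ j, c₁.estimate (E q).1 j ≠ (E q).1 j) ∨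
      ∃ j, c₂.estimate (E q).2 j ≠ (E q).2 j) ?_).trans ?_
    · rintro ⟨z, m⟩ ⟨j, hj⟩
      by_contra! hno
      refine hj ?_
      simp only
      rw [hest, hno.1 j, hno.2 j]
      simp [E]
    · rw [uniformProb_congr_equiv E fun q => (∃ j, c₁.estimate q.1 j ≠ q.1 j) ∨
        ∃ j, c₂.estimate q.2 j ≠ q.2 j]
      refine (uniformProb_or_le _ _).trans (add_le_add ?_ ?_)
      · exact uniformProb_prod_le' c₁.errorProb_nonneg fun _ => c₁.errorProb_eq_uniformProb.ge
      · exact uniformProb_prod_le c₂.errorProb_nonneg fun _ => c₂.errorProb_eq_uniformProb.ge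
  have : Nonempty (∀ j, Z j) := ⟨fun _ => 0⟩
  obtain ⟨z, hz⟩ := exists_uniformProb_le hbound
  exact ⟨code z, (code z).errorProb_eq_uniformProb.trans_le hz⟩

/-- Time sharing, with some loss of rate. -/
lemma Achievable.timeSharing {R₁ R₂ R : Fin N → ℝ} (h₁ : I.Achievable R₁) (h₂ : I.Achievable R₂)
    {a b : ℝ} (ha : 0 < a) (hb : 0 < b) (hab : a + b = 1) (hR : ∀ j, 0 ≤ R j)
    (hlt : ∀ j, R j < a * R₁ j + b * R₂ j) : I.Achievable R := by
  obtain ⟨hR₁, c₁, hc₁⟩ := h₁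
  obtain ⟨hR₂, c₂, hc₂⟩ := h₂
  have hfloor : ∀ {a : ℝ}, 0 < a → Tendsto (fun n : ℕ => ⌊a * (n : ℝ)⌋₊) atTop atTop := fun ha =>
    tendsto_nat_floor_atTop.comp (tendsto_natCast_atTop_atTop.const_mul_atTop ha)
  have hrate : ∀ᶠ n : ℕ in atTop, ∀ j, ⌈(n : ℝ) * R j⌉₊ ≤
      ⌈(⌊a * (n : ℝ)⌋₊ : ℝ) * R₁ j⌉₊ + ⌈(⌊b * (n : ℝ)⌋₊ : ℝ) * R₂ j⌉₊ := by
    refine eventually_all.2 fun j => ?_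
    -- Rounding the two block lengths down loses at most `R₁ j + R₂ j` bits, which `n` times the gap
    -- eventually exceeds. The links need no such slack.
    have hgap : 0 < a * R₁ j + b * R₂ j - R j := by linarith [hlt j]
    filter_upwards [(tendsto_natCast_atTop_atTop.atTop_mul_const hgap).eventually_ge_atTop
      (R₁ j + R₂ j)] with n hn
    refine Nat.ceil_le.2 ?_
    push_cast
    have e1 := Nat.le_ceil ((⌊a * (n : ℝ)⌋₊ : ℝ) * R₁ j)
    have e2 := Nat.le_ceil ((⌊b * (n : ℝ)⌋₊ : ℝ) * R₂ j)
    have f1 := mul_le_mul_of_nonneg_right (Nat.lt_floor_add_one (a * (n : ℝ))).le (hR₁ j)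
    have f2 := mul_le_mul_of_nonneg_right (Nat.lt_floor_add_one (b * (n : ℝ))).le (hR₂ j)
    linarith
  have hlink : ∀ (n : ℕ) (k : Fin K), ⌊(⌊a * (n : ℝ)⌋₊ : ℝ) * I.C k⌋₊ +
      ⌊(⌊b * (n : ℝ)⌋₊ : ℝ) * I.C k⌋₊ ≤ ⌊(n : ℝ) * I.C k⌋₊ := by
    intro n k
    have hCk := (I.C_pos k).le
    refine Nat.le_floor ?_
    push_cast
    have e1 := Nat.floor_le (mul_nonneg (Nat.cast_nonneg (α := ℝ) ⌊a * (n : ℝ)⌋₊) hCk)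
    have e2 := Nat.floor_le (mul_nonneg (Nat.cast_nonneg (α := ℝ) ⌊b * (n : ℝ)⌋₊) hCk)
    have f1 := mul_le_mul_of_nonneg_right
      (Nat.floor_le (mul_nonneg ha.le (Nat.cast_nonneg (α := ℝ) n))) hCk
    have f2 := mul_le_mul_of_nonneg_right
      (Nat.floor_le (mul_nonneg hb.le (Nat.cast_nonneg (α := ℝ) n))) hCk
    have : a * n * I.C k + b * n * I.C k = n * I.C k := by rw [← add_mul, ← add_mul, hab, one_mul]
    linarith
  have hcode : ∀ n : ℕ, ∃ c : I.IndexCode n R, (∀ j, ⌈(n : ℝ) * R j⌉₊ ≤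
      ⌈(⌊a * (n : ℝ)⌋₊ : ℝ) * R₁ j⌉₊ + ⌈(⌊b * (n : ℝ)⌋₊ : ℝ) * R₂ j⌉₊) →
      c.errorProb ≤ (c₁ ⌊a * (n : ℝ)⌋₊).errorProb + (c₂ ⌊b * (n : ℝ)⌋₊).errorProb := by
    intro n
    by_cases hn : ∀ j, ⌈(n : ℝ) * R j⌉₊ ≤
      ⌈(⌊a * (n : ℝ)⌋₊ : ℝ) * R₁ j⌉₊ + ⌈(⌊b * (n : ℝ)⌋₊ : ℝ) * R₂ j⌉₊
    · obtain ⟨c, hc⟩ := exists_concat (c₁ ⌊a * (n : ℝ)⌋₊) (c₂ ⌊b * (n : ℝ)⌋₊) hn (hlink n)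
      exact ⟨c, fun _ => hc⟩
    -- Block lengths too short for the concatenation may use any code.
    · exact ⟨Classical.arbitrary _, fun h => absurd h hn⟩
  choose c hc using hcode
  refine ⟨hR, c, squeeze_zero' (Eventually.of_forall fun n => (c n).errorProb_nonneg)
    (hrate.mono fun n hn => hc n hn) ?_⟩
  simpa using (hc₁.comp (hfloor ha)).add (hc₂.comp (hfloor hb))

/-- Being strictly below an achievable tuple, rather than achievable, provides the slack that
`timeSharing` consumes. -/
lemma convex_setOf_exists_lt_achievable :
    Convex ℝ {R : Fin N → ℝ | (∀ j, 0 ≤ R j) ∧ ∃ R', I.Achievable R' ∧ ∀ j, R j < R' j} := by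
  refine convex_iff_forall_pos.2 ?_
  rintro R₁ ⟨h₁, R₁', hA₁, hlt₁⟩ R₂ ⟨h₂, R₂', hA₂, hlt₂⟩ a b ha hb hab
  have h0 : ∀ j, 0 ≤ a * R₁ j + b * R₂ j := fun j =>
    add_nonneg (mul_nonneg ha.le (h₁ j)) (mul_nonneg hb.le (h₂ j))
  have hlt : ∀ j, a * R₁ j + b * R₂ j < a * R₁' j + b * R₂' j := fun j =>
    add_lt_add (mul_lt_mul_of_pos_left (hlt₁ j) ha) (mul_lt_mul_of_pos_left (hlt₂ j) hb)
  -- The midpoint lies strictly above the combination and strictly below the combined dominating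
  -- tuples, as both requirements are strict.
  refine ⟨h0, fun j => ((a * R₁ j + b * R₂ j) + (a * R₁' j + b * R₂' j)) / 2,
    hA₁.timeSharing hA₂ ha hb hab (fun j => ?_) (fun j => ?_), fun j => ?_⟩
  · linarith [h0 j, hlt j]
  · linarith [hlt j]
  · simp only [Pi.add_apply, Pi.smul_apply, smul_eq_mul]
    linarith [hlt j]

lemma Achievable.of_mem_regionCLS {R : Fin N → ℝ} (hR : R ∈ I.regionCLS) : I.Achievable R := by
  have hsub : I.regionCLS ⊆
      {R : Fin N → ℝ | (∀ j, 0 ≤ R j) ∧ ∃ R', I.Achievable R' ∧ ∀ j, R j < R' j} := by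
    refine convexHull_min (Set.iUnion₂_subset fun Q hQ R hR => ?_) convex_setOf_exists_lt_achievable
    obtain ⟨R', hR', hlt⟩ := exists_lt_mem_regionOfGroups hQ hR
    exact ⟨(Achievable.of_mem_regionOfGroups hR).1, R', .of_mem_regionOfGroups hR', hlt⟩
  obtain ⟨h0, R', hR', hlt⟩ := hsub hR
  -- Sharing `R'` with itself is a way to lower its rates to `R`.
  refine hR'.timeSharing hR' (a := 1 / 2) (b := 1 / 2) (by norm_num) (by norm_num) (by norm_num) h0
    fun j => ?_
  linarith [hlt j]

end IndexCodingProblem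

end

/-- For every admissible family of sender groups and admissible link partition: cooperative
composite coding is reliable at all rates that satisfy the constraints of every group; hence
the region of every admissible family, and the convex hull of their union, are achievable. -/
theorem proposition3 {N K : ℕ} (I : IndexCodingProblem N K) :
    (∀ Q : Finset (Finset (Fin K)), IndexCodingProblem.AdmissibleGroups Q →
      ∀ c : Finset (Fin K) → Fin K → ℝ, I.AdmissibleLinks Q c →
      ∀ (D : ∀ P : Finset (Fin K), I.DecodingChoice P)
        (γ : Finset (Fin K) → Finset (Fin N) → ℝ) (r : Finset (Fin K) → Fin N → ℝ),
        (∀ P ∈ Q, I.GroupConstraints P (c P) (D P) (γ P) (r P)) → I.CCCReliable Q c D γ r) ∧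
    (∀ Q : Finset (Finset (Fin K)), IndexCodingProblem.AdmissibleGroups Q →
      ∀ R ∈ I.regionOfGroups Q, I.Achievable R) ∧
    (∀ R ∈ I.regionCLS, I.Achievable R) :=
  ⟨fun _ _ _ hc D _ _ h => IndexCodingProblem.cccReliable_of_groupConstraints hc D h,
    fun _ _ _ hR => .of_mem_regionOfGroups hR, fun _ hR => .of_mem_regionCLS hR⟩
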